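/- Let $k$ be a number field with ring of integers $\mathfrak{o}$, and fix non-zero integral ideals $\mathfrak{a}_1,\dots,\mathfrak{a}_h$ of $\mathfrak{o}$, one in each ideal class of $k$. For an infinite place $\nu$ of $k$, let $|\cdot|_\nu$ be the absolute value on $k$ extending the usual one on $\mathbb{Q}$, and put $\|x\|_\nu=|x|_\nu^{[k_\nu:\mathbb{R}]}$. For a tuple $\mathbf{r}=(r_\nu)_{\nu\mid\infty}$ of real numbers $r_\nu\ge 1$ put $$L(\mathbf{r})=\{x\in\mathfrak{o} : \|x\|_\nu\le r_\nu \text{ for all } \nu\mid\infty\},\qquad \|\mathbf{r}\|=\prod_{\nu\mid\infty} r_\nu .$$ Let $Z'_3$ be the set of $(x_1,x_2,x_3)\in\mathfrak{o}^3$ such that the ideal of $\mathfrak{o}$ generated by $x_1,x_2,x_3$ is one of $\mathfrak{a}_1,\dots,\mathfrak{a}_h$. For $\underline{\mathbf{r}}=(\mathbf{r}_1,\mathbf{r}_2,\mathbf{r}_3)$ and a point $x\in\mathbb{P}^2(k)$ write $x\in L(\underline{\mathbf{r}})\cap Z'_3$ if $x$ has a representative $(x_1,x_2,x_3)\in Z'_3$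 with $x_i\in L(\mathbf{r}_i)$ for $i=1,2,3$. Then there is a constant $C>0$, depending only on $k$ and the fixed ideals $\mathfrak{a}_1,\dots,\mathfrak{a}_h$, such that for every non-singular ternary quadratic form $Q$ with coefficients in $k$ (that is, one whose underlying symmetric matrix has non-zero determinant) and all tuples $\mathbf{r}_1,\mathbf{r}_2,\mathbf{r}_3$ of real numbers $\ge 1$ indexed by the infinite places of $k$, the set $$\{x=[\mathbf{x}]\in\mathbb{P}^2(k) : Q(\mathbf{x})=0 \text{ and } x\in L(\underline{\mathbf{r}})\cap Z'_3\}$$ is finite and has at most $C\,R^{1/3}$ elements, where $R=\|\mathbf{r}_1\|\,\|\mathbf{r}_2\|\,\|\mathbf{r}_3\|$. -/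

import Mathlib

open scoped NumberField nonZeroDivisors LinearAlgebra.Projectivization

/-- The normalised absolute value `‖x‖_ν = |x|_ν ^ d_ν` at an infinite place `ν`, where
`d_ν = [k_ν : ℝ]` is `1` for real and `2` for complex places. -/
noncomputable def placeNorm {k : Type*} [Field k] (ν : NumberField.InfinitePlace k) (x : k) : ℝ :=
  ν x ^ ν.mult

/-- The box `L(r) = {x ∈ 𝔬 : ‖x‖_ν ≤ r_ν for all ν ∣ ∞}`. -/
def boxSet {k : Type*} [Field k] (r : NumberField.InfinitePlace k → ℝ) : Set (𝓞 k) :=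
  {x | ∀ ν : NumberField.InfinitePlace k, placeNorm ν (x : k) ≤ r ν}

/-- The size `‖r‖ = ∏_{ν ∣ ∞} r_ν` of a box. -/
noncomputable def boxSize {k : Type*} [Field k] [NumberField k]
    (r : NumberField.InfinitePlace k → ℝ) : ℝ :=
  ∏ ν : NumberField.InfinitePlace k, r ν

/-- `a` selects one non-zero integral ideal in every ideal class. -/
def IsClassRepresentatives {k : Type*} [Field k] [NumberField k]
    (a : ClassGroup (𝓞 k) → (Ideal (𝓞 k))⁰) : Prop :=
  ∀ c, ClassGroup.mk0 (a c) = c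

/-- The set `Z'_n` of integral vectors whose coordinates generate one of the chosen ideals. -/
def primitiveVectors {k : Type*} [Field k] [NumberField k]
    (a : ClassGroup (𝓞 k) → (Ideal (𝓞 k))⁰) (n : ℕ) : Set (Fin n → 𝓞 k) :=
  {y | ∃ c, Ideal.span (Set.range y) = (a c : Ideal (𝓞 k))}

/-- The integral vector `y` is a system of homogeneous coordinates of the point `x`. -/
def IsIntegralRep {k : Type*} [Field k] {n : ℕ} (y : Fin n → 𝓞 k) (x : ℙ k (Fin n → k)) : Prop :=
  ∃ h : (fun i => (y i : k)) ≠ 0, x = Projectivization.mk k (fun i => (y i : k)) h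

/-- `x ∈ L(r₁, r₂, r₃) ∩ Z'_3`: some representative of `x` lies in `Z'_3` and in the box. -/
def InBox {k : Type*} [Field k] [NumberField k]
    (a : ClassGroup (𝓞 k) → (Ideal (𝓞 k))⁰) (r : Fin 3 → NumberField.InfinitePlace k → ℝ)
    (x : ℙ k (Fin 3 → k)) : Prop :=
  ∃ y : Fin 3 → 𝓞 k, y ∈ primitiveVectors a 3 ∧ (∀ i, y i ∈ boxSet (r i)) ∧ IsIntegralRep y x

/-- The point `x` is a projective zero of the form `Q`. -/
def IsProjZero {k : Type*} [Field k] {n : ℕ} (Q : QuadraticForm k (Fin n → k))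
    (x : ℙ k (Fin n → k)) : Prop :=
  Q x.rep = 0

theorem isProjZero_mk {k : Type*} [Field k] {n : ℕ} (Q : QuadraticForm k (Fin n → k))
    (v : Fin n → k) (hv : v ≠ 0) : IsProjZero Q (Projectivization.mk k v hv) ↔ Q v = 0 := by
  obtain ⟨c, hc⟩ := Projectivization.exists_smul_eq_mk_rep k v hv
  rw [IsProjZero, ← hc, Units.smul_def, QuadraticMap.map_smul]
  simp

/-- The points counted by `N(Q, r)`. -/
def countedPoints {k : Type*} [Field k] [NumberField k]
    (a : ClassGroup (𝓞 k) → (Ideal (𝓞 k))⁰) (Q : QuadraticForm k (Fin 3 → k))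
    (r : Fin 3 → NumberField.InfinitePlace k → ℝ) : Set (ℙ k (Fin 3 → k)) :=
  {x | IsProjZero Q x ∧ InBox a r x}

/-! This is a determinant method at one fixed prime. Choose a prime `P` of `𝓞 k` not above 2, with
residue field of size `q`, and put `ρ = q ^ (1/3)`. Three distinct points of a non-singular conic
are not collinear, so representatives have non-zero determinant; in the box its norm is at most `6 ^
[k : ℚ] * R` (`abs_norm_det_le`). If this is less than `q ^ j`, the determinant is not divisible by
the `j`-th power of a uniformizer `p` at `P`.

It remains to bound by `C * ρ ^ j` the number of vectors on a conic over the local ring with no such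
divisible triple (`card_le_of_noTripleDvd`), by induction on `j`. Where the conic is smooth mod `p`,
it is locally a graph, and three points whose abscissae agree mod `p ^ m` have determinant divisible
by `p ^ (3 * m)`; with `m` about `j / 3`, pigeonhole gives `O(ρ ^ j)` points. The remaining points
lie on a line mod `p`; a substitution of determinant `p` up to a unit moves them to another conic
and lowers `j` by one. The counts form a geometric series. The local argument needs only a non-zero
matrix, so bad reduction costs nothing and `C` does not depend on `Q`. -/

/-- No three distinct vectors of `S` have a determinant divisible by `c`. -/
def NoTripleDvd {R : Type*} [CommRing R] (c : R) (S : Finset (Fin 3 → R)) : Prop :=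
  ∀ x ∈ S, ∀ y ∈ S, ∀ z ∈ S, x ≠ y → x ≠ z → y ≠ z → ¬ c ∣ (Matrix.of ![x, y, z]).det

theorem NoTripleDvd.mono {R : Type*} [CommRing R] {c : R} {S T : Finset (Fin 3 → R)}
    (hS : NoTripleDvd c S) (hT : T ⊆ S) : NoTripleDvd c T :=
  fun x hx y hy z hz => hS x (hT hx) y (hT hy) z (hT hz)

/-! ### Triangle areas on an affine conic -/

/-- Three points on an affine conic whose abscissae agree modulo `D` span an area divisible by
`D ^ 3`, provided the conic is a graph over the abscissa near these points. -/
theorem pow_three_dvd_area_of_conic {R : Type*} [CommRing R] (a b c d e f D : R) (y z : Fin 3 → R)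
    (h : ∀ n, a + b * y n + c * z n + d * y n ^ 2 + e * (y n * z n) + f * z n ^ 2 = 0)
    (hD : ∀ m n, D ∣ y m - y n)
    (hu : ∀ m n, IsUnit (c + e * y m + f * (z m + z n))) :
    D ^ 3 ∣ (y 1 - y 0) * (z 2 - z 0) - (y 2 - y 0) * (z 1 - z 0) := by
  have key : ∀ m n, (z m - z n) * (c + e * y m + f * (z m + z n)) =
      -(y m - y n) * (b + d * (y m + y n) + e * z n) := by
    intro m n
    linear_combination h m - h n
  have hz : ∀ m n, D ∣ z m - z n := by
    intro m n
    rw [← (hu m n).dvd_mul_right, key]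
    exact Dvd.dvd.mul_right ((dvd_neg).2 (hD m n)) _
  have h1 := key 1 0
  have h2 := key 2 0
  set α1 := b + d * (y 1 + y 0) + e * z 0 with hα1
  set α2 := b + d * (y 2 + y 0) + e * z 0 with hα2
  set β1 := c + e * y 1 + f * (z 1 + z 0) with hβ1
  set β2 := c + e * y 2 + f * (z 2 + z 0) with hβ2
  have hu1 : IsUnit β1 := hu 1 0
  have hu2 : IsUnit β2 := hu 2 0
  rw [← (hu1.mul hu2).dvd_mul_right]
  -- The secants from point 0 have slopes `-α / β`, so the area is the product of two abscissa
  -- differences and a difference of slopes; `h4` extracts the third factor `D` from the latter.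
  have h3 : ((y 1 - y 0) * (z 2 - z 0) - (y 2 - y 0) * (z 1 - z 0)) * (β1 * β2) =
      (y 1 - y 0) * (y 2 - y 0) * (α1 * β2 - α2 * β1) := by
    linear_combination (y 1 - y 0) * β1 * h2 - (y 2 - y 0) * β2 * h1
  rw [h3, pow_succ, pow_two]
  refine mul_dvd_mul (mul_dvd_mul (hD 1 0) (hD 2 0)) ?_
  have h4 : α1 * β2 - α2 * β1 = (y 1 - y 2) * (d * β2) - (y 1 - y 2) * (e * α2) -
      (z 1 - z 2) * (f * α2) := by
    rw [hα1, hα2, hβ1, hβ2]; ring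
  rw [h4]
  exact dvd_sub (dvd_sub ((hD 1 2).mul_right _) ((hD 1 2).mul_right _)) ((hz 1 2).mul_right _)

/-! ### Projective conics over a local ring -/

section LocalRing

variable {R : Type*} [CommRing R] [IsLocalRing R]

open IsLocalRing

theorem isUnit_of_sub_mem_maximalIdeal {x y : R} (hx : IsUnit x) (h : y - x ∈ maximalIdeal R) :
    IsUnit y := by
  by_contra hy
  have h2 : y ∈ maximalIdeal R := (mem_maximalIdeal y).2 hy
  have h3 := (maximalIdeal R).sub_mem h2 h
  rw [sub_sub_cancel] at h3
  exact (mem_maximalIdeal x).1 h3 hx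

/-- Dehomogenise by coordinate 0, with inverses `w n`: the determinant becomes an area up to a unit.
The secant denominators are all congruent to the partial derivative in coordinate 2 at the base
point, a unit because 2 is. -/
theorem pow_three_dvd_det_of_smooth (h2 : IsUnit (2 : R)) {M : Matrix (Fin 3) (Fin 3) R}
    (hM : M.IsSymm) (D : R) (v : Fin 3 → Fin 3 → R) (hv : ∀ n, v n ⬝ᵥ M.mulVec (v n) = 0)
    (hc : ∀ n t, v n t - v 0 t ∈ maximalIdeal R) (hv0 : IsUnit (v 0 0))
    (hv2 : IsUnit (M.mulVec (v 0) 2)) (hD : ∀ m n, D ∣ v m 1 * v n 0 - v n 1 * v m 0) :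
    D ^ 3 ∣ (Matrix.of v).det := by
  have hu : ∀ n, IsUnit (v n 0) := fun n => isUnit_of_sub_mem_maximalIdeal hv0 (hc n 0)
  choose w hw using fun n => (hu n).exists_right_inv
  have e10 : M 1 0 = M 0 1 := hM.apply 0 1
  have e20 : M 2 0 = M 0 2 := hM.apply 0 2
  have e21 : M 2 1 = M 1 2 := hM.apply 1 2
  have hr : ∀ r : R, residue R r = 0 ↔ r ∈ maximalIdeal R := fun r => residue_eq_zero_iff r
  have hres : ∀ n t, residue R (v n t) = residue R (v 0 t) := by
    intro n t
    rw [← sub_eq_zero, ← map_sub, hr]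
    exact hc n t
  have hwres : ∀ n, residue R (w n) = residue R (w 0) := by
    intro n
    have h1 := congrArg (residue R) (hw n)
    have h0 := congrArg (residue R) (hw 0)
    rw [map_mul, map_one] at h1 h0
    rw [hres] at h1
    linear_combination (-residue R (w n)) * h0 + residue R (w 0) * h1
  have key := pow_three_dvd_area_of_conic (M 0 0) (2 * M 0 1) (2 * M 0 2) (M 1 1) (2 * M 1 2)
    (M 2 2) D (fun n => v n 1 * w n) (fun n => v n 2 * w n) ?_ ?_ ?_
  · have e : (Matrix.of v).det = ((v 1 1 * w 1 - v 0 1 * w 0) * (v 2 2 * w 2 - v 0 2 * w 0) -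
        (v 2 1 * w 2 - v 0 1 * w 0) * (v 1 2 * w 1 - v 0 2 * w 0)) * (v 0 0 * v 1 0 * v 2 0) := by
      rw [Matrix.det_fin_three]
      simp only [Matrix.of_apply]
      have a0 := hw 0
      have a1 := hw 1
      have a2 := hw 2
      generalize w 0 = w0 at *
      generalize w 1 = w1 at *
      generalize w 2 = w2 at *
      have b : ∀ (p q : R), (p * w1 - q * w0) * (v 0 0 * v 1 0) = p * v 0 0 - q * v 1 0 := by
        intro p q
        linear_combination p * v 0 0 * a1 - q * v 1 0 * a0
      have b' : ∀ (p q : R), (p * w2 - q * w0) * (v 0 0 * v 2 0) = p * v 0 0 - q * v 2 0 := by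
        intro p q
        linear_combination p * v 0 0 * a2 - q * v 2 0 * a0
      -- After multiplication by `v 0 0` this is Chio condensation of the 3×3 determinant to
      -- bordered minors.
      refine hv0.mul_left_cancel ?_
      linear_combination (-((v 2 2 * w2 - v 0 2 * w0) * (v 0 0 * v 2 0))) * b (v 1 1) (v 0 1)
        - (v 1 1 * v 0 0 - v 0 1 * v 1 0) * b' (v 2 2) (v 0 2)
        + ((v 1 2 * w1 - v 0 2 * w0) * (v 0 0 * v 1 0)) * b' (v 2 1) (v 0 1)
        + (v 2 1 * v 0 0 - v 0 1 * v 2 0) * b (v 1 2) (v 0 2)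
    rw [e]
    exact key.mul_right _
  · intro n
    have h := hv n
    simp only [dotProduct, Matrix.mulVec, Fin.sum_univ_three, e10, e20, e21] at h
    have hn := hw n
    linear_combination (w n) ^ 2 * h - (M 0 0 * (1 + v n 0 * w n) + 2 * M 0 1 * v n 1 * w n
      + 2 * M 0 2 * v n 2 * w n) * hn
  · intro m n
    have : v m 1 * w m - v n 1 * w n = (v m 1 * v n 0 - v n 1 * v m 0) * (w m * w n) := by
      linear_combination -(v m 1 * w m) * hw n + (v n 1 * w n) * hw m
    simp only [this]
    exact (hD m n).mul_right _
  · intro m n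
    have hU : IsUnit (2 * M.mulVec (v 0) 2 * w 0) :=
      (h2.mul hv2).mul (IsUnit.of_mul_eq_one_right _ (hw 0))
    refine isUnit_of_sub_mem_maximalIdeal hU ?_
    rw [← hr]
    simp only [Matrix.mulVec, dotProduct, Fin.sum_univ_three, map_sub, map_add, map_mul, hres m,
      hwres m, hres n, hwres n, e20, e21]
    have h0 := congrArg (residue R) (hw 0)
    rw [map_mul, map_one] at h0
    linear_combination (-(residue R 2) * residue R (M 0 2)) * h0 - residue R (M 2 2) * residue R (v 0 2) * residue R (w 0) * (map_ofNat (residue R) 2)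

/-- The same in an arbitrary chart: permuting the columns changes the determinant only by a sign. -/
theorem pow_three_dvd_det_of_smooth' (h2 : IsUnit (2 : R)) {M : Matrix (Fin 3) (Fin 3) R}
    (hM : M.IsSymm) (D : R) (v : Fin 3 → Fin 3 → R) (hv : ∀ n, v n ⬝ᵥ M.mulVec (v n) = 0)
    (hc : ∀ n t, v n t - v 0 t ∈ maximalIdeal R) (σ : Equiv.Perm (Fin 3))
    (hv0 : IsUnit (v 0 (σ 0))) (hv2 : IsUnit (M.mulVec (v 0) (σ 2)))
    (hD : ∀ m n, D ∣ v m (σ 1) * v n (σ 0) - v n (σ 1) * v m (σ 0)) :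
    D ^ 3 ∣ (Matrix.of v).det := by
  have hmul : ∀ n t, (M.submatrix σ σ).mulVec (v n ∘ σ) t = M.mulVec (v n) (σ t) := by
    intro n t
    simp only [Matrix.mulVec, dotProduct, Matrix.submatrix_apply, Function.comp]
    exact Equiv.sum_comp σ (fun j => M (σ t) j * v n j)
  have h := pow_three_dvd_det_of_smooth h2 (M := M.submatrix σ σ) (hM.submatrix σ) D
    (fun n => v n ∘ σ) ?_ (fun n t => hc n (σ t)) hv0 ?_ hD
  · have e : Matrix.of (fun n => v n ∘ σ) = (Matrix.of v).submatrix id σ := by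
      ext; rfl
    rw [e, Matrix.det_permute'] at h
    rcases Int.units_eq_one_or (Equiv.Perm.sign σ) with hs | hs
    · simpa [hs] using h
    · simpa [hs] using h
  · intro n
    rw [← hv n]
    simp only [dotProduct, hmul, Function.comp]
    exact Equiv.sum_comp σ (fun j => v n j * M.mulVec (v n) j)
  · rw [hmul]; exact hv2

end LocalRing

/-! ### Counting points on a conic over a local ring -/

section DVR

variable {R : Type*} [CommRing R] [IsLocalRing R]

open IsLocalRing Classical

/-- Points of a conic in one smooth residue class. -/
theorem card_le_of_smooth_class (h2 : IsUnit (2 : R)) {M : Matrix (Fin 3) (Fin 3) R}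
    (hM : M.IsSymm) (D : R) [Finite (R ⧸ Ideal.span {D})] {S : Finset (Fin 3 → R)}
    (hS : ∀ x ∈ S, x ⬝ᵥ M.mulVec x = 0) (hT : NoTripleDvd (D ^ 3) S)
    (hc : ∀ x ∈ S, ∀ y ∈ S, ∀ t, x t - y t ∈ maximalIdeal R)
    (hu : ∀ x ∈ S, ∃ i, IsUnit (x i)) (hg : ∀ x ∈ S, ∃ i, IsUnit (M.mulVec x i)) :
    S.card ≤ 2 * Nat.card (R ⧸ Ideal.span {D}) := by
  rcases S.eq_empty_or_nonempty with rfl | ⟨x₀, hx₀⟩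
  · simp
  obtain ⟨i, hi⟩ := hu x₀ hx₀
  -- Since `x₀ ⬝ᵥ M.mulVec x₀ = 0`, the gradient cannot have its only unit coordinate at `i`: the
  -- term at `i` would be a unit equal to minus a sum of non-units.
  have hk : ∃ k, k ≠ i ∧ IsUnit (M.mulVec x₀ k) := by
    by_contra! hcon
    obtain ⟨k, hk⟩ := hg x₀ hx₀
    have hki : k = i := by
      by_contra h
      exact hcon k h hk
    subst hki
    have h0 := hS x₀ hx₀
    rw [dotProduct, ← Finset.add_sum_erase _ _ (Finset.mem_univ k)] at h0
    have hm : ∑ t ∈ Finset.univ.erase k, x₀ t * M.mulVec x₀ t ∈ maximalIdeal R := by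
      refine Ideal.sum_mem _ fun t ht => Ideal.mul_mem_left _ _ ?_
      exact (mem_maximalIdeal _).2 (hcon t (Finset.ne_of_mem_erase ht))
    have hm2 : x₀ k * M.mulVec x₀ k ∈ maximalIdeal R := by
      rw [eq_neg_of_add_eq_zero_left h0]
      exact neg_mem hm
    exact (mem_maximalIdeal _).1 hm2 (hi.mul hk)
  obtain ⟨k, hki, hk⟩ := hk
  obtain ⟨σ, rfl, rfl⟩ : ∃ σ : Equiv.Perm (Fin 3), σ 0 = i ∧ σ 2 = k := by
    clear hi hk
    revert i k
    decide
  have hux : ∀ x ∈ S, IsUnit (x (σ 0)) := fun x hx =>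
    isUnit_of_sub_mem_maximalIdeal hi (hc x hx x₀ hx₀ _)
  have := Fintype.ofFinite (R ⧸ Ideal.span {D})
  let φ : (Fin 3 → R) → R ⧸ Ideal.span {D} := fun x =>
    Ideal.Quotient.mk _ (x (σ 1) * Ring.inverse (x (σ 0)))
  have h := Finset.card_le_mul_card_image (f := φ) S 2 ?_
  · refine h.trans (Nat.mul_le_mul_left _ ?_)
    rw [Nat.card_eq_fintype_card]
    exact Finset.card_le_univ _
  · intro b _
    by_contra! hlt
    obtain ⟨x, hx, y, hy, z, hz, hxy, hxz, hyz⟩ := Finset.two_lt_card.1 hlt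
    rw [Finset.mem_filter] at hx hy hz
    refine hT x hx.1 y hy.1 z hz.1 hxy hxz hyz ?_
    have hmem : ∀ n, ![x, y, z] n ∈ S ∧ φ (![x, y, z] n) = b := by
      intro n; fin_cases n
      exacts [hx, hy, hz]
    have hx0 : ∀ t, x t - x₀ t ∈ maximalIdeal R := hc x hx.1 x₀ hx₀
    refine pow_three_dvd_det_of_smooth' h2 hM D ![x, y, z] (fun n => hS _ (hmem n).1)
      (fun n t => hc _ (hmem n).1 _ (hmem 0).1 t) σ (hux _ hx.1) ?_ ?_
    · refine isUnit_of_sub_mem_maximalIdeal hk ?_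
      simp only [Matrix.mulVec, dotProduct, ← Finset.sum_sub_distrib, ← mul_sub]
      exact Ideal.sum_mem _ fun t _ => Ideal.mul_mem_left _ _ (hx0 t)
    · intro m n
      have hmn := (hmem m).2.trans (hmem n).2.symm
      have hm := Ring.mul_inverse_cancel _ (hux _ (hmem m).1)
      have hn := Ring.mul_inverse_cancel _ (hux _ (hmem n).1)
      generalize ![x, y, z] m = p at *
      generalize ![x, y, z] n = r at *
      rw [Ideal.Quotient.eq, Ideal.mem_span_singleton] at hmn
      have e : p (σ 1) * r (σ 0) - r (σ 1) * p (σ 0) =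
        (p (σ 1) * Ring.inverse (p (σ 0)) - r (σ 1) * Ring.inverse (r (σ 0))) *
          (p (σ 0) * r (σ 0)) := by
        linear_combination (-(p (σ 1) * r (σ 0))) * hm + r (σ 1) * p (σ 0) * hn
      rw [e]
      exact hmn.mul_right _

/-- Points of a conic that are smooth modulo the maximal ideal. -/
theorem card_le_of_smooth (h2 : IsUnit (2 : R)) {M : Matrix (Fin 3) (Fin 3) R}
    (hM : M.IsSymm) (D : R) [Finite (R ⧸ Ideal.span {D})] [Finite (ResidueField R)]
    {S : Finset (Fin 3 → R)}
    (hS : ∀ x ∈ S, x ⬝ᵥ M.mulVec x = 0) (hT : NoTripleDvd (D ^ 3) S)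
    (hg : ∀ x ∈ S, ∃ i, IsUnit (M.mulVec x i)) :
    S.card ≤ 2 * Nat.card (R ⧸ Ideal.span {D}) * Nat.card (ResidueField R) ^ 3 := by
  have := Fintype.ofFinite (ResidueField R)
  let φ : (Fin 3 → R) → (Fin 3 → ResidueField R) := fun x t => residue R (x t)
  have h := Finset.card_le_mul_card_image (f := φ) S (2 * Nat.card (R ⧸ Ideal.span {D})) ?_
  · refine h.trans (Nat.mul_le_mul_left _ ?_)
    refine (Finset.card_le_univ _).trans (le_of_eq ?_)
    rw [Fintype.card_fun, Nat.card_eq_fintype_card, Fintype.card_fin]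
  · intro b _
    have hsub : {a ∈ S | φ a = b} ⊆ S := Finset.filter_subset _ _
    refine card_le_of_smooth_class h2 hM D (fun x hx => hS x (hsub hx)) (hT.mono hsub) ?_ ?_
      (fun x hx => hg x (hsub hx))
    · intro x hx y hy t
      have := congrFun ((Finset.mem_filter.1 hx).2.trans (Finset.mem_filter.1 hy).2.symm) t
      exact Ideal.Quotient.eq.1 this
    · intro x hx
      by_contra! hcon
      obtain ⟨i, hi⟩ := hg x (hsub hx)
      refine (mem_maximalIdeal _).1 ?_ hi
      rw [Matrix.mulVec, dotProduct]
      exact Ideal.sum_mem _ fun t _ =>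
        Ideal.mul_mem_left _ _ ((mem_maximalIdeal _).2 (hcon t))

/-- Points on a line modulo `p` are the image of points under a substitution of determinant
divisible by `p`. -/
theorem exists_substitution_of_dvd {R : Type*} [CommRing R] (p : R) (a : Fin 3 → R) (j : Fin 3)
    (hj : IsUnit (a j)) : ∃ A : Matrix (Fin 3) (Fin 3) R, p ∣ A.det ∧ A.det ∣ p ∧
      ∀ x : Fin 3 → R, p ∣ a ⬝ᵥ x → ∃ y, A.mulVec y = x := by
  obtain ⟨w, hw⟩ := hj.exists_right_inv
  have hdet : (Matrix.updateRow (1 : Matrix (Fin 3) (Fin 3) R) j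
      (fun t => if t = j then w * p else -(w * a t))).det = w * p := by
    fin_cases j <;> simp [Matrix.det_fin_three, Matrix.updateRow_apply]
  -- Row `j` solves `a ⬝ᵥ x = p * c` for `x j`, with `c` as the new coordinate.
  refine ⟨Matrix.updateRow 1 j (fun t => if t = j then w * p else -(w * a t)), ?_, ?_, ?_⟩
  · rw [hdet]; exact Dvd.intro_left _ rfl
  · rw [hdet]; exact ⟨a j, by linear_combination (-p) * hw⟩
  rintro x ⟨c, hc⟩
  refine ⟨Function.update x j c, ?_⟩
  ext t
  simp only [dotProduct, Fin.sum_univ_three] at hc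
  by_cases ht : t = j
  · subst ht
    fin_cases t <;>
    simp [Matrix.mulVec, dotProduct, Fin.sum_univ_three, Matrix.updateRow_apply] at hw hc ⊢
    · linear_combination (-w) * hc + x 0 * hw
    · linear_combination (-w) * hc + x 1 * hw
    · linear_combination (-w) * hc + x 2 * hw
  · simp [Matrix.mulVec, dotProduct, Matrix.updateRow_apply, ht, Matrix.one_apply]

/-- Common factors of the uniformizer are divided out, with induction on a bound for the valuation
of one non-zero entry. The reduced matrix is then non-zero, so its singular points lie on a line. -/
theorem exists_smul_primitive {R : Type*} [CommRing R] [IsDomain R] [IsDiscreteValuationRing R]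
    {M : Matrix (Fin 3) (Fin 3) R} (hM : M.IsSymm) (h0 : M ≠ 0) :
    ∃ (c : R) (N : Matrix (Fin 3) (Fin 3) R), c ≠ 0 ∧ M = c • N ∧ N.IsSymm ∧
      ∃ i j, IsUnit (N i j) := by
  obtain ⟨p, hp⟩ := IsDiscreteValuationRing.exists_irreducible R
  have hij : ∃ i j, M i j ≠ 0 := by
    by_contra! h
    exact h0 (by ext i j; exact h i j)
  obtain ⟨i, j, hij⟩ := hij
  obtain ⟨n, hn⟩ := FiniteMultiplicity.of_not_isUnit hp.not_isUnit hij
  induction n generalizing M with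
  | zero =>
    refine ⟨1, M, one_ne_zero, by simp, hM, i, j, ?_⟩
    by_contra h
    have hm : M i j ∈ maximalIdeal R := (mem_maximalIdeal _).2 h
    rw [hp.maximalIdeal_eq, Ideal.mem_span_singleton] at hm
    exact hn (by simpa using hm)
  | succ n ih =>
    by_cases h : ∃ i j, IsUnit (M i j)
    · exact ⟨1, M, one_ne_zero, by simp, hM, h⟩
    · push Not at h
      have hd : ∀ i j, ∃ b, M i j = p * b := by
        intro i j
        have hm : M i j ∈ maximalIdeal R := (mem_maximalIdeal _).2 (h i j)
        rwa [hp.maximalIdeal_eq, Ideal.mem_span_singleton] at hm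
      choose b hb using hd
      have hbM : M = p • Matrix.of b := by
        ext i j
        simp [hb]
      have hb1 : (Matrix.of b).IsSymm := by
        ext s t
        refine mul_left_cancel₀ hp.ne_zero ?_
        simp only [Matrix.transpose_apply, Matrix.of_apply, ← hb]
        exact hM.apply s t
      have hb2 : Matrix.of b ≠ 0 := fun hb0 => h0 (by rw [hbM, hb0, smul_zero])
      have hb3 : Matrix.of b i j ≠ 0 := by
        intro h
        simp only [Matrix.of_apply] at h
        exact hij (by rw [hb, h, mul_zero])
      have hb4 : ¬ p ^ (n + 1) ∣ Matrix.of b i j := by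
        intro hdvd
        apply hn
        rw [hb, pow_succ']
        exact mul_dvd_mul_left _ hdvd
      obtain ⟨c, N, hc, hN, hs, hu⟩ := ih hb1 hb2 hb3 hb4
      exact ⟨p * c, N, mul_ne_zero hp.ne_zero hc, by rw [hbM, hN, smul_smul], hs, hu⟩

theorem card_quotient_span_pow {R : Type*} [CommRing R] [IsDomain R] [IsDiscreteValuationRing R]
    {p : R} (hp : Irreducible p) (m : ℕ) :
    Nat.card (R ⧸ Ideal.span {p ^ m}) = Nat.card (ResidueField R) ^ m := by
  have := cardQuot_pow_of_prime (P := maximalIdeal R) (IsDiscreteValuationRing.not_a_field R) (i := m)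
  rw [← Ideal.span_singleton_pow, ← hp.maximalIdeal_eq]
  exact this

/-- Points on a conic over a discrete valuation ring with finite residue field of odd
characteristic, no three of which have a determinant divisible by `p ^ j`. -/
theorem card_le_of_noTripleDvd {R : Type*} [CommRing R] [IsDomain R] [IsDiscreteValuationRing R]
    [Finite (ResidueField R)] (h2 : IsUnit (2 : R)) {p : R} (hp : Irreducible p) {ρ C : ℝ}
    (hρ : 1 < ρ) (hρ3 : ρ ^ 3 = Nat.card (ResidueField R)) (hC2 : 2 ≤ C)
    (hC : 2 * (Nat.card (ResidueField R) : ℝ) ^ 4 * ρ ≤ C * (ρ - 1)) (j : ℕ)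
    {M : Matrix (Fin 3) (Fin 3) R} (hM : M.IsSymm) (h0 : M ≠ 0) {S : Finset (Fin 3 → R)}
    (hS : ∀ x ∈ S, x ⬝ᵥ M.mulVec x = 0) (hT : NoTripleDvd (p ^ j) S) :
    (S.card : ℝ) ≤ C * ρ ^ j := by
  set q := Nat.card (ResidueField R) with hq
  induction j generalizing M S with
  | zero =>
    have : S.card ≤ 2 := by
      by_contra! hlt
      obtain ⟨x, hx, y, hy, z, hz, hxy, hxz, hyz⟩ := Finset.two_lt_card.1 hlt
      exact hT x hx y hy z hz hxy hxz hyz (by simp)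
    rw [pow_zero, mul_one]
    exact le_trans (by exact_mod_cast this) hC2
  | succ j ih =>
    obtain ⟨c, N, hc, rfl, hN, s, t, hst⟩ := exists_smul_primitive hM h0
    replace hS : ∀ x ∈ S, x ⬝ᵥ N.mulVec x = 0 := by
      intro x hx
      have := hS x hx
      rw [Matrix.smul_mulVec, dotProduct_smul, smul_eq_mul] at this
      exact (mul_eq_zero.1 this).resolve_left hc
    rw [← Finset.card_filter_add_card_filter_not (s := S) (fun x => ∃ i, IsUnit (N.mulVec x i))]
    set S₁ := {x ∈ S | ∃ i, IsUnit (N.mulVec x i)} with hS₁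
    set S₂ := {x ∈ S | ¬ ∃ i, IsUnit (N.mulVec x i)} with hS₂
    have hsub₁ : S₁ ⊆ S := Finset.filter_subset _ _
    have hsub₂ : S₂ ⊆ S := Finset.filter_subset _ _
    have hq0 : 0 < q := Nat.card_pos
    have hb₁ : (S₁.card : ℝ) ≤ 2 * (q : ℝ) ^ 4 * ρ ^ (j + 1) := by
      -- This ensures `3 * m ≥ j + 1`; rounding up costs one factor `q`, which with the `q ^ 3`
      -- residue classes gives `q ^ 4`.
      set m := (j + 1) / 3 + 1 with hm
      have hfin : Finite (R ⧸ Ideal.span {p ^ m}) := by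
        apply Nat.finite_of_card_ne_zero
        rw [card_quotient_span_pow hp]
        exact pow_ne_zero _ hq0.ne'
      have h := card_le_of_smooth h2 hN (p ^ m) (S := S₁) (fun x hx => hS x (hsub₁ hx)) ?_
        (fun x hx => (Finset.mem_filter.1 hx).2)
      · rw [card_quotient_span_pow hp, ← hq] at h
        have h' : (S₁.card : ℝ) ≤ 2 * (q : ℝ) ^ m * (q : ℝ) ^ 3 := by exact_mod_cast h
        refine h'.trans ?_
        have e : 2 * (q : ℝ) ^ m * (q : ℝ) ^ 3 = 2 * (q : ℝ) ^ 4 * ρ ^ (3 * ((j + 1) / 3)) := by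
          rw [pow_mul, hρ3, hm]; ring
        rw [e]
        have := pow_le_pow_right₀ hρ.le (Nat.mul_div_le (j + 1) 3)
        gcongr
      · intro x hx y hy z hz hxy hxz hyz hd
        refine hT x (hsub₁ hx) y (hsub₁ hy) z (hsub₁ hz) hxy hxz hyz (dvd_trans ?_ hd)
        rw [← pow_mul]
        exact pow_dvd_pow _ (by omega)
    have hb₂ : (S₂.card : ℝ) ≤ C * ρ ^ j := by
      obtain ⟨A, hA, hA', hAx⟩ := exists_substitution_of_dvd p (N s) t hst
      have hA0 : A.det ≠ 0 := fun h => hp.ne_zero (by rwa [h, zero_dvd_iff] at hA')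
      have hex : ∀ x : S₂, ∃ y, A.mulVec y = x := by
        rintro ⟨x, hx⟩
        refine hAx x ?_
        have h1 := (Finset.mem_filter.1 hx).2
        push Not at h1
        have h2 : N.mulVec x s ∈ maximalIdeal R := (mem_maximalIdeal _).2 (h1 s)
        rwa [hp.maximalIdeal_eq, Ideal.mem_span_singleton] at h2
      choose g hg using hex
      have hginj : Function.Injective g := fun x y h => by
        apply Subtype.ext; rw [← hg x, ← hg y, h]
      have hcard : S₂.card = (Finset.univ.image g).card := by
        rw [Finset.card_image_of_injective _ hginj]; simp
      rw [hcard]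
      refine ih (M := A.transpose * N * A) ?_ ?_ ?_ ?_
      · rw [Matrix.IsSymm, Matrix.transpose_mul, Matrix.transpose_mul, Matrix.transpose_transpose,
          hN.eq, Matrix.mul_assoc]
      · intro h
        -- Multiplying by adjugates undoes the substitution up to the non-zero scalar `A.det ^ 2`.
        have hadj := congrArg (fun B => A.adjugate.transpose * B * A.adjugate) h
        simp only [Matrix.mul_zero, Matrix.zero_mul] at hadj
        have e : A.adjugate.transpose * (A.transpose * N * A) * A.adjugate =
            (A * A.adjugate).transpose * N * (A * A.adjugate) := by
          rw [Matrix.transpose_mul]; simp only [Matrix.mul_assoc]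
        rw [e, Matrix.mul_adjugate, Matrix.transpose_smul, Matrix.transpose_one] at hadj
        simp only [Matrix.smul_mul, Matrix.mul_smul, Matrix.one_mul, Matrix.mul_one] at hadj
        have h3 := congrFun (congrFun hadj s) t
        simp only [Matrix.smul_apply, smul_eq_mul, Matrix.zero_apply, mul_eq_zero, hA0,
          false_or] at h3
        exact hst.ne_zero h3
      · intro y hy
        obtain ⟨x, -, rfl⟩ := Finset.mem_image.1 hy
        rw [← Matrix.mulVec_mulVec, ← Matrix.mulVec_mulVec, Matrix.dotProduct_mulVec,
          Matrix.vecMul_transpose, hg]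
        exact hS x (hsub₂ x.2)
      · intro x' hx y' hy z' hz hxy hxz hyz hd
        obtain ⟨x, -, rfl⟩ := Finset.mem_image.1 hx
        obtain ⟨y, -, rfl⟩ := Finset.mem_image.1 hy
        obtain ⟨z, -, rfl⟩ := Finset.mem_image.1 hz
        have hne : ∀ {a b}, g a ≠ g b → (a : Fin 3 → R) ≠ b := fun h h' =>
          h (congrArg g (Subtype.ext h'))
        refine hT x (hsub₂ x.2) y (hsub₂ y.2) z (hsub₂ z.2) (hne hxy) (hne hxz) (hne hyz) ?_
        have e : Matrix.of ![(x : Fin 3 → R), y, z] = Matrix.of ![g x, g y, g z] * A.transpose := by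
          ext n t
          rw [← hg x, ← hg y, ← hg z, Matrix.mul_apply]
          fin_cases n <;> simp [Matrix.mulVec, dotProduct, mul_comm]
        rw [e, Matrix.det_mul, Matrix.det_transpose, pow_succ]
        exact mul_dvd_mul hd hA
    push_cast
    have hpos : 0 < ρ ^ j := pow_pos (by linarith) _
    have := mul_le_mul_of_nonneg_right hC hpos.le
    -- The increment `C * (ρ - 1) * ρ ^ j` absorbs the smooth points; this is what `hC` is chosen
    -- for.
    have e : C * ρ ^ (j + 1) = C * (ρ - 1) * ρ ^ j + C * ρ ^ j := by ring
    have e' : 2 * (q : ℝ) ^ 4 * ρ ^ (j + 1) = 2 * (q : ℝ) ^ 4 * ρ * ρ ^ j := by ring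
    linarith

end DVR

/-! ### Non-collinearity on a non-singular conic -/

theorem det_gram {R : Type*} [CommRing R] (M : Matrix (Fin 3) (Fin 3) R) (v : Fin 3 → Fin 3 → R) :
    (Matrix.of fun m n => v m ⬝ᵥ M.mulVec (v n)).det = M.det * (Matrix.of v).det ^ 2 := by
  have e : (Matrix.of fun m n => v m ⬝ᵥ M.mulVec (v n)) =
      Matrix.of v * (M * (Matrix.of v).transpose) := by
    ext m n
    simp [Matrix.mul_apply, dotProduct, Matrix.mulVec]
  rw [e, Matrix.det_mul, Matrix.det_mul, Matrix.det_transpose]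
  ring

/-- A non-singular conic contains no line. -/
theorem dotProduct_mulVec_ne_zero_of_isotropic {K : Type*} [Field K]
    {M : Matrix (Fin 3) (Fin 3) K} (hM : M.IsSymm) (hdet : M.det ≠ 0) {v w : Fin 3 → K}
    (hv : v ⬝ᵥ M.mulVec v = 0) (hw : w ⬝ᵥ M.mulVec w = 0) (h : LinearIndependent K ![v, w]) :
    v ⬝ᵥ M.mulVec w ≠ 0 := by
  intro h0
  have h0' : w ⬝ᵥ M.mulVec v = 0 := by
    rw [Matrix.dotProduct_mulVec, ← Matrix.mulVec_transpose, hM.eq, dotProduct_comm, h0]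
  -- A basis vector completes `v, w` to a triple of determinant `(v × w) i ≠ 0`, whereas its Gram
  -- matrix has a zero 2×2 block and so is singular.
  obtain ⟨i, hi⟩ := Function.ne_iff.1 (crossProduct_ne_zero_iff_linearIndependent.2 h)
  have hg := det_gram M ![Pi.single i 1, v, w]
  rw [Matrix.det_fin_three] at hg
  simp only [Matrix.of_apply, Matrix.cons_val_zero, Matrix.cons_val_one, Matrix.cons_val, hv, hw,
    h0, h0'] at hg
  have ht : (Matrix.of ![Pi.single i 1, v, w]).det = crossProduct v w i :=
    (triple_product_eq_det (Pi.single i 1) v w).symm.trans (by simp)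
  rw [ht] at hg
  refine mul_ne_zero hdet (pow_ne_zero 2 hi) (hg.symm.trans ?_)
  ring

/-- Three distinct points on a non-singular conic are not collinear. -/
theorem det_ne_zero_of_isotropic {K : Type*} [Field K] (h2 : (2 : K) ≠ 0)
    {M : Matrix (Fin 3) (Fin 3) K} (hM : M.IsSymm) (hdet : M.det ≠ 0) {v : Fin 3 → Fin 3 → K}
    (hv : ∀ n, v n ⬝ᵥ M.mulVec (v n) = 0)
    (h : ∀ m n, m ≠ n → LinearIndependent K ![v m, v n]) : (Matrix.of v).det ≠ 0 := by
  intro h0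
  have hg := det_gram M v
  have hsymm : ∀ m n, v m ⬝ᵥ M.mulVec (v n) = v n ⬝ᵥ M.mulVec (v m) := fun m n => by
    rw [Matrix.dotProduct_mulVec, ← Matrix.mulVec_transpose, hM.eq, dotProduct_comm]
  rw [h0, Matrix.det_fin_three] at hg
  simp only [Matrix.of_apply, hv, hsymm 1 0, hsymm 2 0, hsymm 2 1] at hg
  have hne : ∀ m n, m ≠ n → v m ⬝ᵥ M.mulVec (v n) ≠ 0 := fun m n hmn =>
    dotProduct_mulVec_ne_zero_of_isotropic hM hdet (hv m) (hv n) (h m n hmn)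
  -- A symmetric 3×3 matrix with zero diagonal has determinant twice the product of its off-diagonal
  -- entries.
  refine mul_ne_zero h2 (mul_ne_zero (mul_ne_zero (hne 0 1 (by decide)) (hne 1 2 (by decide)))
    (hne 0 2 (by decide))) ?_
  linear_combination hg

theorem quadraticForm_eq_dotProduct {K : Type*} [Field K] [Invertible (2 : K)]
    (Q : QuadraticForm K (Fin 3 → K)) (v : Fin 3 → K) :
    Q v = v ⬝ᵥ Q.toMatrix'.mulVec v := by
  rw [← Matrix.toLinearMap₂'_apply', QuadraticForm.toMatrix', Matrix.toLinearMap₂'_toMatrix',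
    QuadraticMap.associated_eq_self_apply]

/-! ### Norm bounds and passage to the localization -/

section NumberField

variable {k : Type*} [Field k] [NumberField k]

open NumberField

theorem abs_norm_det_le {r : Fin 3 → InfinitePlace k → ℝ} {y : Fin 3 → Fin 3 → 𝓞 k}
    (hy : ∀ n i, y n i ∈ boxSet (r i)) :
    |(Algebra.norm ℤ (Matrix.of y).det : ℝ)| ≤
      6 ^ Module.finrank ℚ k * (boxSize (r 0) * boxSize (r 1) * boxSize (r 2)) := by
  have hn : |(Algebra.norm ℤ (Matrix.of y).det : ℝ)| =
      ∏ ν : InfinitePlace k, ν ((Matrix.of y).det : k) ^ ν.mult := by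
    rw [InfinitePlace.prod_eq_abs_norm, ← Algebra.coe_norm_int]
    push_cast
    rfl
  rw [hn, boxSize, boxSize, boxSize, ← InfinitePlace.sum_mult_eq, ← Finset.prod_pow_eq_pow_sum,
    ← Finset.prod_mul_distrib, ← Finset.prod_mul_distrib, ← Finset.prod_mul_distrib]
  refine Finset.prod_le_prod (fun ν _ => by positivity) fun ν _ => ?_
  have hm : ν.mult ≠ 0 := InfinitePlace.mult_ne_zero
  -- The maxima are taken for `ν` itself, which satisfies the triangle inequality, and only later
  -- raised to the power `ν.mult`.
  set s : Fin 3 → ℝ := fun i => max (max (ν (y 0 i : k)) (ν (y 1 i : k))) (ν (y 2 i : k)) with hs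
  have hle : ∀ n i, ν (y n i : k) ≤ s i := by
    intro n i
    fin_cases n <;> simp [hs]
  have hs0 : ∀ i, 0 ≤ s i := fun i => (apply_nonneg ν _).trans (hle 0 i)
  have hsr : ∀ i, s i ^ ν.mult ≤ r i ν := by
    intro i
    have hex : ∃ n, s i = ν (y n i : k) := by
      simp only [hs]
      rcases max_choice (max (ν (y 0 i : k)) (ν (y 1 i : k))) (ν (y 2 i : k)) with h | h
      · rcases max_choice (ν (y 0 i : k)) (ν (y 1 i : k)) with h' | h'
        · exact ⟨0, h.trans h'⟩
        · exact ⟨1, h.trans h'⟩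
      · exact ⟨2, h⟩
    obtain ⟨n, hn⟩ := hex
    rw [hn]
    exact hy n i ν
  have hterm : ∀ a b c, ν ((y a 0 : k) * (y b 1 : k) * (y c 2 : k)) ≤ s 0 * s 1 * s 2 := by
    intro a b c
    rw [map_mul, map_mul]
    have h0 := hle a 0
    have h1 := hle b 1
    have h2 := hle c 2
    have := hs0 0
    have := hs0 1
    gcongr
  have hdet : ν ((Matrix.of y).det : k) ≤ 6 * (s 0 * s 1 * s 2) := by
    have e : ((Matrix.of y).det : k) = (y 0 0 : k) * (y 1 1 : k) * (y 2 2 : k) -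
        (y 0 0 : k) * (y 2 1 : k) * (y 1 2 : k) - (y 1 0 : k) * (y 0 1 : k) * (y 2 2 : k) +
        (y 2 0 : k) * (y 0 1 : k) * (y 1 2 : k) + (y 1 0 : k) * (y 2 1 : k) * (y 0 2 : k) -
        (y 2 0 : k) * (y 1 1 : k) * (y 0 2 : k) := by
      rw [Matrix.det_fin_three]
      simp only [Matrix.of_apply, map_add, map_sub, map_mul]
      ring
    have hadd : ∀ a b : k, ν (a + b) ≤ ν a + ν b := fun a b => ν.1.add_le a b
    have hsub : ∀ a b : k, ν (a - b) ≤ ν a + ν b := fun a b => by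
      have h := ν.1.add_le a (-b)
      rwa [AbsoluteValue.map_neg, ← sub_eq_add_neg] at h
    rw [e]
    refine (hsub _ _).trans ?_
    refine (add_le_add_left (hadd _ _) _).trans ?_
    refine (add_le_add_left (add_le_add_left (hadd _ _) _) _).trans ?_
    refine (add_le_add_left (add_le_add_left (add_le_add_left (hsub _ _) _) _) _).trans ?_
    refine (add_le_add_left (add_le_add_left (add_le_add_left (add_le_add_left
      (hsub _ _) _) _) _) _).trans ?_
    linarith [hterm 0 1 2, hterm 0 2 1, hterm 1 0 2, hterm 2 0 1, hterm 1 2 0, hterm 2 1 0]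
  calc ν ((Matrix.of y).det : k) ^ ν.mult ≤ (6 * (s 0 * s 1 * s 2)) ^ ν.mult := by gcongr
    _ = 6 ^ ν.mult * (s 0 ^ ν.mult * s 1 ^ ν.mult * s 2 ^ ν.mult) := by
      rw [mul_pow, mul_pow, mul_pow]
    _ ≤ 6 ^ ν.mult * (r 0 ν * r 1 ν * r 2 ν) := by
      have h0 := hsr 0
      have h1 := hsr 1
      have h2 := hsr 2
      have p0 : 0 ≤ s 0 ^ ν.mult := pow_nonneg (hs0 0) _
      have p1 : 0 ≤ s 1 ^ ν.mult := pow_nonneg (hs0 1) _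
      have p2 : 0 ≤ s 2 ^ ν.mult := pow_nonneg (hs0 2) _
      have q0 := p0.trans h0
      have q1 := p1.trans h1
      gcongr

-- A prime above 3 serves, since `3 - 2 = 1`. It depends only on `k`, and so do `q`, `ρ` and `C`.
variable (k) in
theorem exists_maximal_ideal_two_notMem :
    ∃ P : Ideal (𝓞 k), P.IsMaximal ∧ P ≠ ⊥ ∧ (2 : 𝓞 k) ∉ P := by
  have hmax : (Ideal.span {(3 : ℤ)}).IsMaximal :=
    PrincipalIdealRing.isMaximal_of_irreducible Int.prime_three.irreducible
  obtain ⟨P, hP, hover⟩ :=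
    Ideal.exists_maximal_ideal_liesOver_of_isIntegral (S := 𝓞 k) (Ideal.span {(3 : ℤ)})
  have h3 : (3 : 𝓞 k) ∈ P := by
    have : (3 : ℤ) ∈ P.under ℤ := hover.over ▸ Ideal.mem_span_singleton_self 3
    simpa using this
  refine ⟨P, hP, ?_, fun h2 => hP.ne_top ((Ideal.eq_top_iff_one P).2 ?_)⟩
  · rintro rfl
    exact (by norm_num : (3 : 𝓞 k) ≠ 0) ((Submodule.mem_bot _).1 h3)
  · have := P.sub_mem h3 h2
    norm_num at this
    exact this

/-- Elements of `𝓞 k` divisible by the `j`-th power of a local uniformizer have large norm. -/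
theorem card_residueField_pow_le_abs_norm (P : Ideal (𝓞 k)) [P.IsMaximal]
    {p : Localization.AtPrime P}
    (hp : IsLocalRing.maximalIdeal (Localization.AtPrime P) = Ideal.span {p}) {d : 𝓞 k}
    (hd : d ≠ 0) {j : ℕ} (h : p ^ j ∣ algebraMap (𝓞 k) (Localization.AtPrime P) d) :
    (Nat.card (IsLocalRing.ResidueField (Localization.AtPrime P)) : ℝ) ^ j ≤
      |(Algebra.norm ℤ d : ℝ)| := by
  have hmem : d ∈ P ^ j := by
    rw [← IsLocalization.AtPrime.under_maximalIdeal_pow P (Localization.AtPrime P) j, hp,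
      Ideal.span_singleton_pow]
    exact Ideal.mem_span_singleton.2 h
  have hcard : Nat.card (IsLocalRing.ResidueField (Localization.AtPrime P)) = Ideal.absNorm P := by
    rw [Ideal.absNorm_apply]
    exact (Nat.card_congr
      (IsLocalization.AtPrime.equivQuotMaximalIdeal P (Localization.AtPrime P)).toEquiv).symm
  have hdvd := Ideal.absNorm_dvd_absNorm_of_le ((Ideal.span_singleton_le_iff_mem _).2 hmem)
  rw [map_pow, Ideal.absNorm_span_singleton, ← hcard] at hdvd
  have hle := Nat.le_of_dvd (Int.natAbs_pos.2 (Algebra.norm_ne_zero_iff.2 hd)) hdvd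
  have : ((Algebra.norm ℤ d).natAbs : ℝ) = |(Algebra.norm ℤ d : ℝ)| := by
    rw [Nat.cast_natAbs, Int.cast_abs]
  rw [← this]
  exact_mod_cast hle

/-- A symmetric matrix over `k` is proportional to one over `𝓞 k`. -/
theorem exists_integral_multiple {M : Matrix (Fin 3) (Fin 3) k} (hM : M.IsSymm) :
    ∃ (b : k) (N : Matrix (Fin 3) (Fin 3) (𝓞 k)), b ≠ 0 ∧ N.IsSymm ∧
      N.map (algebraMap (𝓞 k) k) = b • M := by
  obtain ⟨b, hb⟩ := IsLocalization.exist_integer_multiples_of_finite (𝓞 k)⁰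
    (fun ij : Fin 3 × Fin 3 => M ij.1 ij.2)
  choose N hN using hb
  have hmap : (Matrix.of fun i j => N (i, j)).map (algebraMap (𝓞 k) k) = ((b : 𝓞 k) : k) • M := by
    ext i j
    simp [hN, Algebra.smul_def]
  refine ⟨((b : 𝓞 k) : k), Matrix.of fun i j => N (i, j), ?_, ?_, hmap⟩
  · simp
  · ext i j
    have h1 := congrFun (congrFun hmap i) j
    have h2 := congrFun (congrFun hmap j) i
    rw [Matrix.smul_apply, hM.apply i j] at h2
    rw [Matrix.smul_apply, ← h2] at h1
    exact h1.symm

theorem map_dotProduct_mulVec {R S : Type*} [CommRing R] [CommRing S] (f : R →+* S)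
    (M : Matrix (Fin 3) (Fin 3) R) (v : Fin 3 → R) :
    (f ∘ v) ⬝ᵥ (M.map f).mulVec (f ∘ v) = f (v ⬝ᵥ M.mulVec v) := by
  simp [dotProduct, Matrix.mulVec]

theorem map_det_of_vec {R S : Type*} [CommRing R] [CommRing S] (f : R →+* S)
    (v : Fin 3 → Fin 3 → R) : (Matrix.of fun n => f ∘ v n).det = f (Matrix.of v).det := by
  rw [RingHom.map_det]
  rfl

variable (k) in
/-- There are `O(ρ ^ j)` points of a non-singular conic in any set of integral vectors whose
determinants have norm less than `ρ ^ (3 * j)`. -/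
theorem exists_card_le_of_norm_det_lt : ∃ ρ C : ℝ, 1 < ρ ∧ 2 ≤ C ∧
    ∀ (Q : QuadraticForm k (Fin 3 → k)), Q.toMatrix'.det ≠ 0 →
    ∀ (T : Finset (ℙ k (Fin 3 → k))), (∀ x ∈ T, IsProjZero Q x) →
    ∀ (y : ℙ k (Fin 3 → k) → Fin 3 → 𝓞 k), (∀ x ∈ T, IsIntegralRep (y x) x) →
    ∀ j : ℕ, (∀ x : Fin 3 → ℙ k (Fin 3 → k), (∀ n, x n ∈ T) →
      |(Algebra.norm ℤ (Matrix.of fun n => y (x n)).det : ℝ)| < ρ ^ (3 * j)) →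
    (T.card : ℝ) ≤ C * ρ ^ j := by
  classical
  obtain ⟨P, hPmax, hP0, hP2⟩ := exists_maximal_ideal_two_notMem k
  let O := Localization.AtPrime P
  have hdvr : IsDiscreteValuationRing O :=
    IsLocalization.AtPrime.isDiscreteValuationRing_of_dedekind_domain (𝓞 k) hP0 O
  have hfinP : Finite (𝓞 k ⧸ P) := Ring.HasFiniteQuotients.finiteQuotient hP0
  have hfin : Finite (IsLocalRing.ResidueField O) :=
    Finite.of_equiv _ (IsLocalization.AtPrime.equivQuotMaximalIdeal P O).toEquiv
  set f : 𝓞 k →+* O := algebraMap (𝓞 k) O with hf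
  have hinj : Function.Injective f :=
    IsLocalization.injective O P.primeCompl_le_nonZeroDivisors
  have h2 : IsUnit (2 : O) := by
    have := (IsLocalization.AtPrime.isUnit_to_map_iff O P (2 : 𝓞 k)).2 hP2
    rwa [map_ofNat] at this
  obtain ⟨p, hp⟩ := IsDiscreteValuationRing.exists_irreducible O
  set q := Nat.card (IsLocalRing.ResidueField O) with hq
  have hq1 : 1 < q := Finite.one_lt_card
  have hq1' : (1 : ℝ) < q := by exact_mod_cast hq1
  set ρ : ℝ := (q : ℝ) ^ (1 / 3 : ℝ) with hρ
  have hρ1 : 1 < ρ := Real.one_lt_rpow hq1' (by norm_num)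
  have hρ3 : ρ ^ 3 = q := by
    rw [hρ, ← Real.rpow_natCast, ← Real.rpow_mul (by positivity)]
    norm_num
  have hρ0 : 0 < ρ - 1 := by linarith
  refine ⟨ρ, max 2 (2 * (q : ℝ) ^ 4 * ρ / (ρ - 1)), hρ1, le_max_left _ _, ?_⟩
  intro Q hQ T hT y hy j hj
  have hM := QuadraticForm.isSymm_toMatrix' Q
  obtain ⟨b, N, hb, hN, hNM⟩ := exists_integral_multiple hM
  have hzero : ∀ x ∈ T, y x ⬝ᵥ N.mulVec (y x) = 0 := by
    intro x hx
    obtain ⟨h0, hx'⟩ := hy x hx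
    have hQ0 := hT x hx
    rw [hx', isProjZero_mk, quadraticForm_eq_dotProduct] at hQ0
    apply RingOfIntegers.coe_injective
    rw [← map_dotProduct_mulVec, hNM, Matrix.smul_mulVec, dotProduct_smul]
    exact (congrArg (b • ·) hQ0).trans (by simp)
  have hyinj : Set.InjOn (fun x => f ∘ y x) T := by
    intro x hx x' hx' h
    have hyy : y x = y x' := by
      ext1 i
      exact hinj (congrFun h i)
    obtain ⟨h0, e⟩ := hy x hx
    obtain ⟨h0', e'⟩ := hy x' hx'
    rw [e, e']
    simp only [hyy]
  have hcard : T.card = (T.image fun x => f ∘ y x).card := (Finset.card_image_of_injOn hyinj).symm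
  rw [hcard]
  refine card_le_of_noTripleDvd h2 hp hρ1 hρ3 (le_max_left _ _) ?_ j (M := N.map f) ?_ ?_ ?_ ?_
  · rw [← div_le_iff₀ hρ0]
    exact le_max_right _ _
  · exact hN.map f
  · intro h
    have hN0 : N = 0 := by
      ext s t
      have := congrFun (congrFun h s) t
      rw [Matrix.map_apply, Matrix.zero_apply, map_eq_zero_iff f hinj] at this
      rw [this]; rfl
    rw [hN0, Matrix.map_zero _ (map_zero _), eq_comm, smul_eq_zero] at hNM
    apply hQ
    rw [hNM.resolve_left hb, Matrix.det_zero]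
  · intro v hv
    obtain ⟨x, hx, rfl⟩ := Finset.mem_image.1 hv
    rw [map_dotProduct_mulVec, hzero x hx, map_zero]
  · intro v0 hv0 v1 hv1 v2 hv2 h01 h02 h12 hd
    obtain ⟨x0, hx0, rfl⟩ := Finset.mem_image.1 hv0
    obtain ⟨x1, hx1, rfl⟩ := Finset.mem_image.1 hv1
    obtain ⟨x2, hx2, rfl⟩ := Finset.mem_image.1 hv2
    set x : Fin 3 → ℙ k (Fin 3 → k) := ![x0, x1, x2] with hx
    have hxT : ∀ n, x n ∈ T := by
      intro n; fin_cases n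
      exacts [hx0, hx1, hx2]
    have e : (Matrix.of ![f ∘ y x0, f ∘ y x1, f ∘ y x2]) = Matrix.of fun n => f ∘ y (x n) := by
      ext n i; fin_cases n <;> rfl
    rw [e, map_det_of_vec f (fun n => y (x n))] at hd
    have hxne : ∀ m n, m ≠ n → x m ≠ x n := by
      have a01 : x0 ≠ x1 := fun h => h01 (by rw [h])
      have a02 : x0 ≠ x2 := fun h => h02 (by rw [h])
      have a12 : x1 ≠ x2 := fun h => h12 (by rw [h])
      intro m n hmn
      fin_cases m <;> fin_cases n
      exacts [absurd rfl hmn, a01, a02, a01.symm, absurd rfl hmn, a12, a02.symm, a12.symm,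
        absurd rfl hmn]
    -- Distinct points of the conic are not collinear, so the determinant is non-zero and
    -- divisibility by `p ^ j` forces norm at least `q ^ j = ρ ^ (3 * j)`.
    have hdet : (Matrix.of fun n => y (x n)).det ≠ 0 := by
      intro h
      have h' := congrArg (algebraMap (𝓞 k) k) h
      rw [← map_det_of_vec, map_zero] at h'
      refine det_ne_zero_of_isotropic two_ne_zero hM hQ
        (v := fun n => algebraMap (𝓞 k) k ∘ y (x n)) ?_ ?_ h'
      · intro n
        obtain ⟨h0, e⟩ := hy (x n) (hxT n)
        have hQ0 := hT (x n) (hxT n)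
        rw [e, isProjZero_mk, quadraticForm_eq_dotProduct] at hQ0
        exact hQ0
      · intro m n hmn
        obtain ⟨h0, e⟩ := hy (x m) (hxT m)
        obtain ⟨h0', e'⟩ := hy (x n) (hxT n)
        have hne := hxne m n hmn
        rw [e, e', ne_comm, Ne, Projectivization.mk_eq_mk_iff'] at hne
        push Not at hne
        exact (LinearIndependent.pair_iff' h0).2 hne
    have h1 := card_residueField_pow_le_abs_norm P hp.maximalIdeal_eq hdet hd
    have h3 := hj x hxT
    rw [pow_mul, hρ3] at h3
    exact absurd h1 (not_le.2 h3)

end NumberField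

/-! ### The global bound -/

theorem theorem4p6 (k : Type*) [Field k] [NumberField k]
    (a : ClassGroup (𝓞 k) → (Ideal (𝓞 k))⁰) (ha : IsClassRepresentatives a) :
    ∃ C : ℝ, 0 < C ∧
      ∀ (Q : QuadraticForm k (Fin 3 → k)), (QuadraticForm.toMatrix' Q).det ≠ 0 →
      ∀ (r : Fin 3 → NumberField.InfinitePlace k → ℝ), (∀ i ν, 1 ≤ r i ν) →
        (countedPoints a Q r).Finite ∧
        ((countedPoints a Q r).ncard : ℝ) ≤
          C * (boxSize (r 0) * boxSize (r 1) * boxSize (r 2)) ^ (1 / 3 : ℝ) := by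
  classical
  obtain ⟨ρ, C, hρ, hC, H⟩ := exists_card_le_of_norm_det_lt k
  set E : ℝ := 6 ^ Module.finrank ℚ k with hE
  have hE1 : 1 ≤ E := one_le_pow₀ (by norm_num)
  refine ⟨C * ρ * E ^ (1 / 3 : ℝ), by positivity, fun Q hQ r hr => ?_⟩
  set R := boxSize (r 0) * boxSize (r 1) * boxSize (r 2) with hR
  have hbox : ∀ i, 1 ≤ boxSize (r i) := fun i => by
    rw [boxSize, ← Finset.prod_const_one (s := Finset.univ (α := NumberField.InfinitePlace k))]
    exact Finset.prod_le_prod (fun _ _ => zero_le_one) fun ν _ => hr i ν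
  have hR1 : 1 ≤ R := one_le_mul_of_one_le_of_one_le
    (one_le_mul_of_one_le_of_one_le (hbox 0) (hbox 1)) (hbox 2)
  have hER : 1 ≤ E * R := one_le_mul_of_one_le_of_one_le hE1 hR1
  have hρ3 : 1 < ρ ^ 3 := one_lt_pow₀ hρ (by norm_num)
  -- The exponent used is `j + 1`, the first with `E * R < ρ ^ (3 * (j + 1))`; the overshoot is the
  -- factor `ρ` in the constant.
  obtain ⟨j, hj1, hj2⟩ := exists_nat_pow_near hER hρ3
  -- A uniform bound for finite subsets yields finiteness as well.
  have hmain : ∀ T : Finset (ℙ k (Fin 3 → k)), (T : Set _) ⊆ countedPoints a Q r →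
      (T.card : ℝ) ≤ C * ρ * E ^ (1 / 3 : ℝ) * R ^ (1 / 3 : ℝ) := by
    intro T hT
    have hex : ∀ x, ∃ y : Fin 3 → 𝓞 k, x ∈ T → (∀ i, y i ∈ boxSet (r i)) ∧ IsIntegralRep y x := by
      intro x
      by_cases hx : x ∈ T
      · obtain ⟨y, -, h⟩ := (hT hx).2
        exact ⟨y, fun _ => h⟩
      · exact ⟨0, fun h => absurd h hx⟩
    choose y hy using hex
    have h := H Q hQ T (fun x hx => (hT hx).1) y (fun x hx => (hy x hx).2) (j + 1) ?_
    · refine h.trans ?_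
      have hle : ρ ^ j ≤ (E * R) ^ (1 / 3 : ℝ) := by
        rw [← pow_mul, mul_comm, pow_mul] at hj1
        have h1 := Real.rpow_le_rpow (by positivity) hj1 (show (0 : ℝ) ≤ 1 / 3 by norm_num)
        rwa [← Real.rpow_natCast, ← Real.rpow_mul (by positivity),
          show ((3 : ℕ) : ℝ) * (1 / 3) = 1 by norm_num, Real.rpow_one] at h1
      rw [Real.mul_rpow (by positivity) (by positivity)] at hle
      calc C * ρ ^ (j + 1) = C * ρ * ρ ^ j := by ring
        _ ≤ C * ρ * (E ^ (1 / 3 : ℝ) * R ^ (1 / 3 : ℝ)) := by gcongr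
        _ = _ := by ring
    · intro x hx
      refine (abs_norm_det_le fun n i => (hy (x n) (hx n)).1 i).trans_lt ?_
      rw [pow_mul]
      exact hj2
  have hfin : (countedPoints a Q r).Finite := by
    by_contra hinf
    obtain ⟨T, hT, hcard⟩ := Set.Infinite.exists_subset_card_eq hinf
      (⌊C * ρ * E ^ (1 / 3 : ℝ) * R ^ (1 / 3 : ℝ)⌋₊ + 1)
    have h := hmain T hT
    rw [hcard] at h
    push_cast at h
    exact absurd h (not_le.2 (Nat.lt_floor_add_one _))
  refine ⟨hfin, ?_⟩
  rw [Set.ncard_eq_toFinset_card _ hfin]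
  exact hmain _ (by simp)
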